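/- Let $d,N\ge 0$ be integers, and let $B_1,\dots,B_d:\mathbb R^d\to\mathrm{Mat}_{N\times N}(\mathbb K)$ ($\mathbb K=\mathbb R$ or $\mathbb C$) be smooth. Repeated indices are summed over $1,\dots,d$. Put $D_\mu f=\partial_\mu f+B_\mu f$, let $A_1=-D_\mu D_\mu$ be the covariant Laplace operator, and put $$F_{\nu\mu}=\partial_\nu B_\mu-\partial_\mu B_\nu+[B_\nu,B_\mu],\qquad \nabla_\mu G=\partial_\mu G+[B_\mu,G].$$ Consider the system for the Seeley--DeWitt coefficients $a_n(x,y)\in \mathrm{Mat}_{N\times N}(\mathbb K)$ of $A_1$, i.e. the coefficients of the expansion $(4\pi\tau)^{-d/2}e^{-|x-y|^2/(4\tau)}\sum_{n\ge0}\tau^n a_n(x,y)$ of its heat kernel: $$a_0(y,y)=1,\qquad (x-y)^\mu D_{x^\mu}a_0(x,y)=0,\qquad \bigl((n+1)+(x-y)^\mu D_{x^\mu}\bigr)a_{n+1}(x,y)=-A_1a_n(x,y)\quad(n\ge0),$$ where $A_1$ acts on the variable $x$ and each $a_n(x,y)$ is required to be smooth in $x\in\mathbb R^d$ for every fixed $y\in\mathbb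 R^d$. With $z(s)=(1-s)y+sx$, let $\Phi(x,y)=\sum_{n\ge0}\Phi_n(x,y)$, with $\Phi_0=1$ and $\Phi_{n+1}(x,y)=-\int_0^1(x-y)^\nu B_\nu(z(s))\,\Phi_n(z(s),y)\,ds$, be the path-ordered exponential of $-B$ along the segment from $y$ to $x$. Then: 1. The functions given recursively by $a_0(x,y)=\Phi(x,y)$ and $a_{n+1}(x,y)=-\int_0^1 s^n\,\Phi(x,z(s))\,(A_1a_n)(z(s),y)\,ds$ are a solution of this system. 2. For every solution $(a_n)_{n\ge0}$ of this system and every $x\in\mathbb R^d$, $$\begin{aligned}a_3(x,x)={}&\tfrac1{45}\nabla_\mu F_{\tau\nu}(x)\nabla_\mu F_{\tau\nu}(x)+\tfrac1{180}\nabla_\mu F_{\mu\nu}(x)\nabla_\tau F_{\tau\nu}(x)\\&+\tfrac1{60}\bigl(F_{\tau\nu}(x)\nabla_\mu\nabla_\mu F_{\tau\nu}(x)+\nabla_\mu\nabla_\mu F_{\tau\nu}(x)F_{\tau\nu}(x)\bigr)-\tfrac1{30}F_{\tau\mu}(x)F_{\mu\nu}(x)F_{\nu\tau}(x).\end{aligned}$$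 -/

import Mathlib

open scoped ContDiff

attribute [local instance] Matrix.linftyOpNormedRing Matrix.linftyOpNormedAlgebra

noncomputable section

namespace HeatKernel

variable {d : ℕ} {𝔸 : Type*} [NormedRing 𝔸] [NormedAlgebra ℝ 𝔸]

/-- The partial derivative `∂_μ f` of a function on `ℝ^d`. -/
def partialDeriv (μ : Fin d) (f : EuclideanSpace ℝ (Fin d) → 𝔸) :
    EuclideanSpace ℝ (Fin d) → 𝔸 :=
  fun x => fderiv ℝ f x (EuclideanSpace.single μ (1 : ℝ))

/-- The covariant derivative `D_μ f = ∂_μ f + B_μ f`; the field acts by left multiplication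
(for matrix-valued `f` this is the action on each column). -/
def covDeriv (B : Fin d → EuclideanSpace ℝ (Fin d) → 𝔸) (μ : Fin d)
    (f : EuclideanSpace ℝ (Fin d) → 𝔸) : EuclideanSpace ℝ (Fin d) → 𝔸 :=
  fun x => partialDeriv μ f x + B μ x * f x

/-- The covariant Laplace operator `A₁ f = - D_μ D_μ f`. -/
def covLaplace (B : Fin d → EuclideanSpace ℝ (Fin d) → 𝔸)
    (f : EuclideanSpace ℝ (Fin d) → 𝔸) : EuclideanSpace ℝ (Fin d) → 𝔸 :=
  fun x => - ∑ μ, covDeriv B μ (covDeriv B μ f) x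

/-- The field strength `F_{νμ} = ∂_ν B_μ - ∂_μ B_ν + [B_ν, B_μ]`. -/
def fieldStrength (B : Fin d → EuclideanSpace ℝ (Fin d) → 𝔸) (ν μ : Fin d) :
    EuclideanSpace ℝ (Fin d) → 𝔸 :=
  fun x => partialDeriv ν (B μ) x - partialDeriv μ (B ν) x + ⁅B ν x, B μ x⁆

/-- The adjoint covariant derivative `∇_μ G = ∂_μ G + [B_μ, G]`. -/
def adjDeriv (B : Fin d → EuclideanSpace ℝ (Fin d) → 𝔸) (μ : Fin d)
    (G : EuclideanSpace ℝ (Fin d) → 𝔸) : EuclideanSpace ℝ (Fin d) → 𝔸 :=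
  fun x => partialDeriv μ G x + ⁅B μ x, G x⁆

/-- The point `z(s) = (1 - s) y + s x` of the segment from `y` to `x`. -/
def segPoint (x y : EuclideanSpace ℝ (Fin d)) (s : ℝ) : EuclideanSpace ℝ (Fin d) :=
  (1 - s) • y + s • x

/-- The summand of order `n` of the path-ordered exponential: the iterated integral
`(-1)^n ∫ … ∫ ds₁ … dsₙ (dz₁^{ν₁}/ds₁) … (dzₙ^{νₙ}/dsₙ) B_{ν₁}(z₁) … B_{νₙ}(zₙ)`, where `z₁` runs
over the segment from `y` to `x` and `z_j` over the segment from `y` to `z_{j-1}`. -/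
def pExpTerm (B : Fin d → EuclideanSpace ℝ (Fin d) → 𝔸) :
    ℕ → EuclideanSpace ℝ (Fin d) → EuclideanSpace ℝ (Fin d) → 𝔸
  | 0, _, _ => 1
  | n + 1, x, y => - ∫ s in (0 : ℝ)..1,
      (∑ ν, (x ν - y ν) • B ν (segPoint x y s)) * pExpTerm B n (segPoint x y s) y

/-- The path-ordered exponential `Φ(x, y)` of `-B` along the segment from `y` to `x`. -/
def pExp (B : Fin d → EuclideanSpace ℝ (Fin d) → 𝔸) (x y : EuclideanSpace ℝ (Fin d)) : 𝔸 :=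
  ∑' n, pExpTerm B n x y

/-- The Seeley–DeWitt coefficients `a_n(x, y)` of the covariant Laplace operator:
`a₀ = Φ` and `a_{n+1}(x, y) = - ∫₀¹ s^n Φ(x, z(s)) (A₁ a_n)(z(s), y) ds`,
where `A₁` acts on the first argument. -/
def seeleyDeWitt (B : Fin d → EuclideanSpace ℝ (Fin d) → 𝔸) :
    ℕ → EuclideanSpace ℝ (Fin d) → EuclideanSpace ℝ (Fin d) → 𝔸
  | 0 => pExp B
  | n + 1 => fun x y => - ∫ s in (0 : ℝ)..1,
      s ^ n • (pExp B x (segPoint x y s) *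
        covLaplace B (fun z => seeleyDeWitt B n z y) (segPoint x y s))

/-- The classical solutions of the recursive system for the coefficients of the expansion
`K₁(x, y; τ) = (4πτ)^{-d/2} exp(-|x-y|²/(4τ)) ∑ τ^n a_n(x, y)`
of the heat kernel of the covariant Laplace operator. -/
structure IsClassicalSolution (B : Fin d → EuclideanSpace ℝ (Fin d) → 𝔸)
    (a : ℕ → EuclideanSpace ℝ (Fin d) → EuclideanSpace ℝ (Fin d) → 𝔸) : Prop where
  smooth : ∀ n y, ContDiff ℝ ∞ (fun x => a n x y)
  diag_zero : ∀ y, a 0 y y = 1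
  transport_zero : ∀ x y, ∑ μ, (x μ - y μ) • covDeriv B μ (fun z => a 0 z y) x = 0
  transport_succ : ∀ (n : ℕ) x y,
    ((n : ℝ) + 1) • a (n + 1) x y
        + ∑ μ, (x μ - y μ) • covDeriv B μ (fun z => a (n + 1) z y) x
      = - covLaplace B (fun z => a n z y) x

end HeatKernel

end

/-! Existence. Restricted to the segment from y to x, `pExp` is the Neumann series solving the
Volterra equation u = 1 - V_b u in C(I, 𝔸), where b is the connection form along the segment. Since
‖V_b ^ n‖ ≤ ‖b‖ ^ n / n!, the operator 1 + V_b is invertible, and smoothness of inversion makes Φ(x,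
y) smooth in x (`contDiff_pExp`). ODE uniqueness gives the composition law along a line
(`pExp_segPoint_mul`), so Φ(y, x) is the inverse of Φ(x, y). Hence a_{n+1} is Φ(x, y) times an
integral of a function of z(s) alone (`seeleyDeWitt_succ`), and the transport equations follow by
differentiating along the ray.

Diagonal value. Fix y and let R = (x - y)^μ D_μ. Since [D_μ, (x - y)^ν] = δ_{μν}, a word in the D's
applied to R f and evaluated at y is the sum, over the letters, of the words on f in which that
letter is moved to the innermost place. The transport equations thus become linear relations between
fully contracted words at y: they express a_3(y, y) through six-letter words on a_0
(`evalAt_third_coefficient`), while R a_0 = 0 supplies relations among those words. The curvature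
formula also expands into such words, because F_{μν} acts as [D_μ, D_ν] and ∇_μ G as [D_μ, G]. The
equality is then finite linear algebra (`contracted_words_eq`). No uniqueness theorem for the system
is needed. -/

noncomputable section

namespace HeatKernel

open Set unitInterval

/-! ### Smooth dependence on a parameter, with values in C(I, E). -/

section ParametricSmoothness

variable {X E : Type*} [NormedAddCommGroup X] [NormedSpace ℝ X]
  [NormedAddCommGroup E] [NormedSpace ℝ E]

/-- The continuous function `t ↦ f (x, t)` on the unit interval. -/
def curryUnit (f : X × ℝ → E) (hf : Continuous f) (x : X) : C(I, E) :=
  ⟨fun t => f (x, t), by fun_prop⟩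

omit [NormedSpace ℝ X] [NormedSpace ℝ E] in
theorem continuous_curryUnit (f : X × ℝ → E) (hf : Continuous f) :
    Continuous (curryUnit f hf) := by
  have h : Continuous (fun p : X × I => f (p.1, (p.2 : ℝ))) := by fun_prop
  exact (ContinuousMap.curry ⟨_, h⟩).continuous

/-- The partial derivative of `f` in its first argument, in the direction `v`. -/
def fderivFst (f : X × ℝ → E) (v : X) (p : X × ℝ) : E := fderiv ℝ f p (v, 0)

theorem contDiff_fderivFst {f : X × ℝ → E} (hf : ContDiff ℝ ∞ f) (v : X) :
    ContDiff ℝ ∞ (fderivFst f v) := by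
  have := hf.fderiv_right (m := ∞) (by simp)
  exact this.clm_apply contDiff_const

/-- The remainder must be small uniformly in t. The partial derivative, curried, is continuous into
the sup norm, so one ball around x serves every t in the mean value inequality. Finite dimension
makes the candidate derivative automatically continuous. -/
theorem hasFDerivAt_curryUnit [FiniteDimensional ℝ X] {f : X × ℝ → E} (hf : ContDiff ℝ ∞ f)
    (x : X) : ∃ L : X →L[ℝ] C(I, E), HasFDerivAt (curryUnit f hf.continuous) L x ∧
      ∀ v, L v = curryUnit (fderivFst f v) (contDiff_fderivFst hf v).continuous x := by
  let L₀ : X →ₗ[ℝ] C(I, E) :=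
    { toFun := fun v => curryUnit (fderivFst f v) (contDiff_fderivFst hf v).continuous x
      map_add' := fun v w => by
        ext t
        have : ((v + w, 0) : X × ℝ) = (v, 0) + (w, 0) := by simp
        simp only [curryUnit, fderivFst, ContinuousMap.coe_mk, ContinuousMap.add_apply]
        rw [this, map_add]
      map_smul' := fun c v => by
        ext t
        have : ((c • v, 0) : X × ℝ) = c • (v, 0) := by simp
        simp only [curryUnit, fderivFst, ContinuousMap.coe_mk, ContinuousMap.smul_apply, RingHom.id_apply]
        rw [this, map_smul] }
  refine ⟨LinearMap.toContinuousLinearMap L₀, ?_, fun v => rfl⟩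
  let g : X × ℝ → X →L[ℝ] E := fun p => (fderiv ℝ f p).comp (ContinuousLinearMap.inl ℝ X ℝ)
  have hg : Continuous g :=
    (hf.continuous_fderiv (by simp)).clm_comp continuous_const
  have hpart : ∀ (z : X) (t : ℝ), HasFDerivAt (fun z => f (z, t)) (g (z, t)) z := fun z t =>
    ((hf.differentiable (by simp) (z, t)).hasFDerivAt).comp z
      (hasFDerivAt_prodMk_left z t)
  rw [hasFDerivAt_iff_isLittleO, Asymptotics.isLittleO_iff]
  intro ε hε
  have hc := (continuous_curryUnit g hg).continuousAt (x := x)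
  obtain ⟨δ, hδ, hball⟩ := Metric.continuousAt_iff.1 hc ε hε
  filter_upwards [Metric.ball_mem_nhds x hδ] with z hz
  rw [ContinuousMap.norm_le _ (by positivity)]
  intro t
  refine (convex_ball x δ).norm_image_sub_le_of_norm_hasFDerivWithin_le' (𝕜 := ℝ)
    (f := fun z => f (z, (t : ℝ))) (f' := fun z => g (z, t)) (φ := g (x, t))
    (fun w _ => (hpart w t).hasFDerivWithinAt) (fun w hw => ?_) (Metric.mem_ball_self hδ) hz
  have h1 := (ContinuousMap.norm_coe_le_norm (curryUnit g hg w - curryUnit g hg x) t).trans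
    ((dist_eq_norm _ _).symm.trans_le (hball hw).le)
  exact h1

/-- Each directional derivative of a curried function is again a curried smooth function, so the
induction on the order closes. -/
theorem contDiff_curryUnit [FiniteDimensional ℝ X] {f : X × ℝ → E} (hf : ContDiff ℝ ∞ f) :
    ContDiff ℝ ∞ (curryUnit f hf.continuous) := by
  rw [contDiff_infty]
  intro n
  induction n generalizing f with
  | zero => exact contDiff_zero.2 (continuous_curryUnit f hf.continuous)
  | succ n ih =>
    rw [Nat.cast_succ, contDiff_succ_iff_fderiv_apply]
    refine ⟨fun x => ?_, by simp, fun v => ?_⟩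
    · obtain ⟨L, hL, -⟩ := hasFDerivAt_curryUnit hf x
      exact hL.differentiableAt
    · convert ih (contDiff_fderivFst hf v) using 2 with x
      obtain ⟨L, hL, hL'⟩ := hasFDerivAt_curryUnit hf x
      rw [hL.fderiv, hL']

/-- The primitive `s ↦ ∫₀ˢ g` of a continuous function on the unit interval. -/
def primitiveUnit (E : Type*) [NormedAddCommGroup E] [NormedSpace ℝ E] :
    C(I, E) →L[ℝ] C(I, E) :=
  LinearMap.mkContinuous
    { toFun := fun g => ⟨fun s => ∫ t in (0 : ℝ)..s, g (projIcc 0 1 zero_le_one t), by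
        have h : Continuous (fun s : ℝ => ∫ t in (0 : ℝ)..s, g (projIcc 0 1 zero_le_one t)) :=
          intervalIntegral.continuous_primitive (fun a b => Continuous.intervalIntegrable
            (by fun_prop) a b) 0
        fun_prop⟩
      map_add' := fun g h => by
        ext s
        simp only [ContinuousMap.add_apply, ContinuousMap.coe_mk]
        exact intervalIntegral.integral_add (Continuous.intervalIntegrable (by fun_prop) _ _)
          (Continuous.intervalIntegrable (by fun_prop) _ _)
      map_smul' := fun c g => by
        ext s
        simp }
    1 (fun g => by
      rw [ContinuousMap.norm_le _ (by positivity)]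
      intro s
      have := intervalIntegral.norm_integral_le_of_norm_le_const (a := (0 : ℝ)) (b := s)
        (f := fun t => g (projIcc 0 1 zero_le_one t)) (C := ‖g‖)
        (fun t _ => g.norm_coe_le_norm _)
      refine this.trans ?_
      rw [sub_zero, abs_of_nonneg s.2.1, one_mul]
      exact mul_le_of_le_one_right (norm_nonneg _) s.2.2)

theorem primitiveUnit_apply (g : C(I, E)) (s : I) :
    primitiveUnit E g s = ∫ t in (0 : ℝ)..s, g (projIcc 0 1 zero_le_one t) := rfl

theorem primitiveUnit_eq {g : C(I, E)} {f : ℝ → E} (h : ∀ t : I, g t = f t) (s : I) :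
    primitiveUnit E g s = ∫ t in (0 : ℝ)..s, f t := by
  rw [primitiveUnit_apply]
  refine intervalIntegral.integral_congr fun t ht => ?_
  rw [uIcc_of_le s.2.1] at ht
  have ht' : t ∈ Icc (0 : ℝ) 1 := ⟨ht.1, ht.2.trans s.2.2⟩
  simp only [projIcc_of_mem zero_le_one ht', h]

theorem contDiff_integral_unit [FiniteDimensional ℝ X] {f : X × ℝ → E}
    (hf : ContDiff ℝ ∞ f) : ContDiff ℝ ∞ (fun x => ∫ t in (0 : ℝ)..1, f (x, t)) := by
  have h := (ContinuousMap.evalCLM ℝ (1 : I)).contDiff.comp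
    ((primitiveUnit E).contDiff.comp (contDiff_curryUnit hf))
  convert h using 2 with x
  exact (primitiveUnit_eq (g := curryUnit f hf.continuous x) (fun t => rfl) 1).symm

end ParametricSmoothness

/-! ### Volterra operators and the smooth dependence of their resolvents. -/

section Volterra

variable {𝔸 : Type*} [NormedRing 𝔸] [NormedAlgebra ℝ 𝔸]

theorem summable_neg_pow_of_norm_pow_le {R : Type*} [NormedRing R] [CompleteSpace R] {x : R}
    {C : ℝ} (h : ∀ n : ℕ, ‖x ^ n‖ ≤ C ^ n / n.factorial) : Summable fun n => (-x) ^ n := by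
  refine Summable.of_norm_bounded (Real.summable_pow_div_factorial C) fun n => ?_
  rw [neg_pow]
  -- The norm of 1 in R need not be 1, so the sign is removed by parity and not by multiplicativity
  -- of norms.
  rcases neg_one_pow_eq_or R n with h' | h'
  · rw [h', one_mul]
    exact h n
  · rw [h', neg_one_mul, norm_neg]
    exact h n

/-- The unit `1 + x`, for an element `x` whose powers decay like those of a Volterra operator. -/
def unitOneAdd {R : Type*} [NormedRing R] [CompleteSpace R] (x : R) {C : ℝ}
    (h : ∀ n : ℕ, ‖x ^ n‖ ≤ C ^ n / n.factorial) : Rˣ where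
  val := 1 + x
  inv := ∑' n, (-x) ^ n
  val_inv := by
    simpa using (summable_neg_pow_of_norm_pow_le h).one_sub_mul_tsum_pow
  inv_val := by
    simpa using (summable_neg_pow_of_norm_pow_le h).tsum_pow_mul_one_sub

theorem contDiffAt_inverse_one_add {R : Type*} [NormedRing R] [NormedAlgebra ℝ R]
    [CompleteSpace R] {x : R} {C : ℝ} (h : ∀ n : ℕ, ‖x ^ n‖ ≤ C ^ n / n.factorial) :
    ContDiffAt ℝ ∞ Ring.inverse (1 + x) :=
  contDiffAt_ringInverse ℝ (unitOneAdd x h)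

theorem contDiffAt_inverse_one_add_apply {V R : Type*} [NormedAddCommGroup V] [NormedSpace ℝ V]
    [NormedRing R] [NormedAlgebra ℝ R] [CompleteSpace R] (T : V →L[ℝ] R) {b : V} {C : ℝ}
    (h : ∀ n : ℕ, ‖T b ^ n‖ ≤ C ^ n / n.factorial) :
    ContDiffAt ℝ ∞ (fun b => Ring.inverse (1 + T b)) b :=
  ContDiffAt.comp b (g := Ring.inverse) (f := fun b => 1 + T b) (contDiffAt_inverse_one_add h)
    (contDiff_const.add T.contDiff).contDiffAt

theorem hasSum_neg_pow_apply {W : Type*} [NormedAddCommGroup W] [NormedSpace ℝ W]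
    [CompleteSpace W] {T : W →L[ℝ] W} {C : ℝ} (h : ∀ n : ℕ, ‖T ^ n‖ ≤ C ^ n / n.factorial)
    (w : W) : HasSum (fun n => ((-T) ^ n) w) ((∑' n, (-T) ^ n) w) :=
  (summable_neg_pow_of_norm_pow_le h).hasSum.mapL (ContinuousLinearMap.apply ℝ W w)

/-- The Volterra operator `u ↦ (s ↦ ∫₀ˢ b u)`. -/
def volterra : C(I, 𝔸) →L[ℝ] C(I, 𝔸) →L[ℝ] C(I, 𝔸) :=
  (ContinuousLinearMap.compL ℝ C(I, 𝔸) C(I, 𝔸) C(I, 𝔸) (primitiveUnit 𝔸)).comp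
    (ContinuousLinearMap.mul ℝ C(I, 𝔸))

theorem volterra_apply (b u : C(I, 𝔸)) : volterra b u = primitiveUnit 𝔸 (b * u) := rfl

/-- The factor s ^ n has to be carried along: integrating it is what produces the factorial. -/
theorem norm_volterra_pow_apply_le (b u : C(I, 𝔸)) (n : ℕ) (s : I) :
    ‖((volterra b) ^ n) u s‖ ≤ (‖b‖ * s) ^ n / n.factorial * ‖u‖ := by
  induction n generalizing s with
  | zero => simpa using u.norm_coe_le_norm s
  | succ n ih =>
    rw [pow_succ', mul_apply_eq_comp, volterra_apply, primitiveUnit_apply]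
    have h : ∀ t ∈ Ioc (0 : ℝ) s,
        ‖(b * (volterra b ^ n) u) (projIcc 0 1 zero_le_one t)‖ ≤
          ‖b‖ * ((‖b‖ * t) ^ n / n.factorial * ‖u‖) := by
      intro t ht
      have ht' : t ∈ Icc (0 : ℝ) 1 := ⟨ht.1.le, ht.2.trans s.2.2⟩
      rw [projIcc_of_mem zero_le_one ht', ContinuousMap.mul_apply]
      exact (norm_mul_le _ _).trans
        (mul_le_mul (b.norm_coe_le_norm _) (ih ⟨t, ht'⟩) (norm_nonneg _) (norm_nonneg _))
    refine (intervalIntegral.norm_integral_le_of_norm_le s.2.1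
      (Filter.Eventually.of_forall h) (Continuous.intervalIntegrable (by fun_prop) _ _)).trans ?_
    have e : (fun t : ℝ => ‖b‖ * ((‖b‖ * t) ^ n / n.factorial * ‖u‖)) =
        fun t => (‖b‖ ^ (n + 1) / n.factorial * ‖u‖) * t ^ n := by
      funext t
      rw [mul_pow]
      ring
    rw [e, intervalIntegral.integral_const_mul, integral_pow, Nat.factorial_succ]
    apply le_of_eq
    push_cast
    have := Nat.factorial_ne_zero n
    field_simp
    rw [zero_pow n.succ_ne_zero]
    ring

theorem norm_volterra_pow_le (b : C(I, 𝔸)) (n : ℕ) :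
    ‖(volterra b) ^ n‖ ≤ ‖b‖ ^ n / n.factorial := by
  refine ContinuousLinearMap.opNorm_le_bound _ (by positivity) fun u => ?_
  rw [ContinuousMap.norm_le _ (by positivity)]
  intro s
  refine (norm_volterra_pow_apply_le b u n s).trans ?_
  have h0 := s.2.1
  have h1 := s.2.2
  gcongr
  exact mul_le_of_le_one_right (norm_nonneg _) h1

variable [CompleteSpace 𝔸]

/-- The unit `1 + V_b` of the algebra of operators, where `V_b` is the Volterra operator. -/
def volterraUnit (b : C(I, 𝔸)) : (C(I, 𝔸) →L[ℝ] C(I, 𝔸))ˣ :=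
  unitOneAdd (volterra b) (norm_volterra_pow_le b)

/-- The solution `u` of the Volterra equation `u(s) = 1 - ∫₀ˢ b u`. -/
def volterraSolution (b : C(I, 𝔸)) : C(I, 𝔸) := (∑' n, (-volterra b) ^ n) 1

theorem contDiff_volterraSolution :
    ContDiff ℝ ∞ (volterraSolution : C(I, 𝔸) → C(I, 𝔸)) := by
  have h : (volterraSolution : C(I, 𝔸) → C(I, 𝔸)) =
      fun b => Ring.inverse (1 + volterra b) 1 := by
    funext b
    have : Ring.inverse (1 + volterra b) = ∑' n, (-volterra b) ^ n :=
      Ring.inverse_unit (volterraUnit b)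
    rw [this]
    rfl
  rw [h]
  refine ContDiff.clm_apply ?_ contDiff_const
  rw [contDiff_iff_contDiffAt]
  intro b
  exact contDiffAt_inverse_one_add_apply _ (norm_volterra_pow_le b)

theorem volterraSolution_eq (b : C(I, 𝔸)) :
    volterraSolution b = 1 - volterra b (volterraSolution b) := by
  have h : ((1 + volterra b) * ∑' n, (-volterra b) ^ n) 1 = (1 : C(I, 𝔸)) :=
    DFunLike.congr_fun (volterraUnit b).val_inv 1
  exact eq_sub_of_add_eq h

theorem hasSum_volterraSolution (b : C(I, 𝔸)) (s : I) :
    HasSum (fun n => ((-volterra b) ^ n) (1 : C(I, 𝔸)) s) (volterraSolution b s) := by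
  have h : HasSum (fun n => ((-volterra b) ^ n) (1 : C(I, 𝔸))) (volterraSolution b) :=
    hasSum_neg_pow_apply (norm_volterra_pow_le b) 1
  exact h.mapL (ContinuousMap.evalCLM ℝ s)

end Volterra

end HeatKernel

end

noncomputable section

namespace HeatKernel

open Set unitInterval

variable {d : ℕ} {𝔸 : Type*} [NormedRing 𝔸] [NormedAlgebra ℝ 𝔸]

/-! ### Geometry of segments. -/

section Segment

theorem segPoint_segPoint (x y : EuclideanSpace ℝ (Fin d)) (s t : ℝ) :
    segPoint (segPoint x y s) y t = segPoint x y (s * t) := by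
  simp only [segPoint]
  module

theorem segPoint_zero (x y : EuclideanSpace ℝ (Fin d)) : segPoint x y 0 = y := by
  simp [segPoint]

theorem segPoint_one (x y : EuclideanSpace ℝ (Fin d)) : segPoint x y 1 = x := by
  simp [segPoint]

theorem segPoint_translate (x y : EuclideanSpace ℝ (Fin d)) (r t : ℝ) :
    segPoint (segPoint x y r + (x - y)) (segPoint x y r) (t - r) = segPoint x y t := by
  simp only [segPoint]
  module

theorem segPoint_sub_apply (x y : EuclideanSpace ℝ (Fin d)) (s : ℝ) (ν : Fin d) :
    segPoint x y s ν - y ν = s * (x ν - y ν) := by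
  simp [segPoint]
  ring

theorem contDiff_segPoint (y : EuclideanSpace ℝ (Fin d)) :
    ContDiff ℝ ∞ (fun p : EuclideanSpace ℝ (Fin d) × ℝ => segPoint p.1 y p.2) := by
  unfold segPoint
  fun_prop

theorem continuous_segPoint (x y : EuclideanSpace ℝ (Fin d)) : Continuous (segPoint x y) := by
  unfold segPoint
  fun_prop

theorem hasDerivAt_segPoint (x y : EuclideanSpace ℝ (Fin d)) (t : ℝ) :
    HasDerivAt (segPoint x y) (x - y) t := by
  have h : segPoint x y = fun s => y + s • (x - y) := by
    funext s
    simp only [segPoint]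
    module
  rw [h]
  simpa using ((hasDerivAt_id t).smul_const (x - y)).const_add y

theorem hasDerivAt_comp_segPoint {f : EuclideanSpace ℝ (Fin d) → 𝔸} (hf : ContDiff ℝ ∞ f)
    (x y : EuclideanSpace ℝ (Fin d)) (t : ℝ) :
    HasDerivAt (fun t => f (segPoint x y t))
      (∑ μ, (x μ - y μ) • partialDeriv μ f (segPoint x y t)) t := by
  have h := ((hf.differentiable (by simp) (segPoint x y t)).hasFDerivAt).comp_hasDerivAt t
    (hasDerivAt_segPoint x y t)
  have e : x - y = ∑ μ, (x μ - y μ) • EuclideanSpace.single μ (1 : ℝ) := by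
    ext ν
    simp [Finset.sum_apply, Pi.single_apply]
  have e' : fderiv ℝ f (segPoint x y t) (x - y) =
      ∑ μ, (x μ - y μ) • partialDeriv μ f (segPoint x y t) := by
    rw [e, map_sum]
    simp [partialDeriv]
  rw [e'] at h
  exact h

end Segment

section Smoothness

theorem contDiff_partialDeriv {f : EuclideanSpace ℝ (Fin d) → 𝔸} (hf : ContDiff ℝ ∞ f)
    (μ : Fin d) : ContDiff ℝ ∞ (partialDeriv μ f) :=
  (hf.fderiv_right (m := ∞) (by simp)).clm_apply contDiff_const

variable {B : Fin d → EuclideanSpace ℝ (Fin d) → 𝔸} (hB : ∀ μ, ContDiff ℝ ∞ (B μ))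
include hB

theorem contDiff_covDeriv {f : EuclideanSpace ℝ (Fin d) → 𝔸} (hf : ContDiff ℝ ∞ f)
    (μ : Fin d) : ContDiff ℝ ∞ (covDeriv B μ f) :=
  (contDiff_partialDeriv hf μ).add ((hB μ).mul hf)

theorem contDiff_covLaplace {f : EuclideanSpace ℝ (Fin d) → 𝔸} (hf : ContDiff ℝ ∞ f) :
    ContDiff ℝ ∞ (covLaplace B f) :=
  (ContDiff.sum fun μ _ => contDiff_covDeriv hB (contDiff_covDeriv hB hf μ) μ).neg

theorem contDiff_adjDeriv {f : EuclideanSpace ℝ (Fin d) → 𝔸} (hf : ContDiff ℝ ∞ f)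
    (μ : Fin d) : ContDiff ℝ ∞ (adjDeriv B μ f) :=
  (contDiff_partialDeriv hf μ).add (((hB μ).mul hf).sub (hf.mul (hB μ)))

theorem contDiff_fieldStrength (ν μ : Fin d) : ContDiff ℝ ∞ (fieldStrength B ν μ) :=
  ((contDiff_partialDeriv (hB μ) ν).sub (contDiff_partialDeriv (hB ν) μ)).add
    (((hB ν).mul (hB μ)).sub ((hB μ).mul (hB ν)))

end Smoothness

/-! ### The path-ordered exponential: transport equation, composition law, smoothness. -/

section PathOrderedExponential

/-- The pairing `(x - y)^ν B_ν(z(s))` of the connection form with the velocity of the segment. -/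
def segForm (B : Fin d → EuclideanSpace ℝ (Fin d) → 𝔸) (y : EuclideanSpace ℝ (Fin d))
    (p : EuclideanSpace ℝ (Fin d) × ℝ) : 𝔸 :=
  ∑ ν, (p.1 ν - y ν) • B ν (segPoint p.1 y p.2)

variable {B : Fin d → EuclideanSpace ℝ (Fin d) → 𝔸}

theorem segForm_segPoint (x y : EuclideanSpace ℝ (Fin d)) (s t : ℝ) :
    segForm B y (segPoint x y s, t) = s • segForm B y (x, s * t) := by
  simp only [segForm, segPoint_segPoint, segPoint_sub_apply, Finset.smul_sum, mul_smul]

theorem segForm_translate (x y : EuclideanSpace ℝ (Fin d)) (r t : ℝ) :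
    segForm B (segPoint x y r) (segPoint x y r + (x - y), t - r) = segForm B y (x, t) := by
  simp only [segForm, segPoint_translate]
  simp

theorem pExpTerm_succ_segPoint (n : ℕ) (x y : EuclideanSpace ℝ (Fin d)) (s : ℝ) :
    pExpTerm B (n + 1) (segPoint x y s) y =
      -∫ t in (0 : ℝ)..s, segForm B y (x, t) * pExpTerm B n (segPoint x y t) y := by
  have h := intervalIntegral.smul_integral_comp_mul_left (a := 0) (b := 1)
    (fun t => segForm B y (x, t) * pExpTerm B n (segPoint x y t) y) s
  rw [mul_zero, mul_one] at h
  rw [← h, ← intervalIntegral.integral_smul]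
  change -∫ t in (0 : ℝ)..1, segForm B y (segPoint x y s, t) *
    pExpTerm B n (segPoint (segPoint x y s) y t) y = _
  simp only [segForm_segPoint, segPoint_segPoint, smul_mul_assoc]

variable (hB : ∀ μ, ContDiff ℝ ∞ (B μ))
include hB

theorem contDiff_segForm (y : EuclideanSpace ℝ (Fin d)) : ContDiff ℝ ∞ (segForm B y) := by
  refine ContDiff.sum fun ν _ =>
    ContDiff.smul (f := fun p : EuclideanSpace ℝ (Fin d) × ℝ => p.1 ν - y ν) (by fun_prop) ?_
  exact (hB ν).comp (contDiff_segPoint y)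

theorem pExpTerm_segPoint (n : ℕ) (x y : EuclideanSpace ℝ (Fin d)) (s : I) :
    pExpTerm B n (segPoint x y s) y =
      ((-volterra (curryUnit (segForm B y) (contDiff_segForm hB y).continuous x)) ^ n)
        (1 : C(I, 𝔸)) s := by
  induction n generalizing s with
  | zero => rfl
  | succ n ih =>
    rw [pExpTerm_succ_segPoint, pow_succ', mul_apply_eq_comp, neg_apply,
      ContinuousMap.neg_apply, volterra_apply]
    congr 1
    refine (primitiveUnit_eq (fun t => ?_) s).symm
    rw [ContinuousMap.mul_apply, ih]
    rfl

variable [CompleteSpace 𝔸]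

theorem pExp_segPoint (x y : EuclideanSpace ℝ (Fin d)) (s : I) :
    pExp B (segPoint x y s) y =
      volterraSolution (curryUnit (segForm B y) (contDiff_segForm hB y).continuous x) s := by
  have h := (hasSum_volterraSolution
    (curryUnit (segForm B y) (contDiff_segForm hB y).continuous x) s).tsum_eq
  simp only [← pExpTerm_segPoint hB] at h
  exact h

theorem contDiff_pExp (y : EuclideanSpace ℝ (Fin d)) : ContDiff ℝ ∞ (fun x => pExp B x y) := by
  have h := (ContinuousMap.evalCLM ℝ (1 : I)).contDiff.comp
    (contDiff_volterraSolution.comp (contDiff_curryUnit (contDiff_segForm hB y)))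
  convert h using 2 with x
  have h1 := pExp_segPoint hB x y 1
  rw [Icc.coe_one, segPoint_one] at h1
  exact h1

theorem pExp_eq_one_sub_integral (x y : EuclideanSpace ℝ (Fin d)) :
    pExp B x y =
      1 - ∫ t in (0 : ℝ)..1, segForm B y (x, t) * pExp B (segPoint x y t) y := by
  have h1 := pExp_segPoint hB x y 1
  rw [Icc.coe_one, segPoint_one] at h1
  rw [h1, volterraSolution_eq, ContinuousMap.sub_apply, volterra_apply]
  congr 1
  refine primitiveUnit_eq (fun t => ?_) 1
  rw [ContinuousMap.mul_apply, ← pExp_segPoint hB]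
  rfl

/-- Rescaling the segment carries the integral equation to every real s, also outside [0, 1]; a
two-sided derivative at s = 1 requires this. -/
theorem pExp_segPoint_eq_one_sub_integral (x y : EuclideanSpace ℝ (Fin d)) (s : ℝ) :
    pExp B (segPoint x y s) y =
      1 - ∫ t in (0 : ℝ)..s, segForm B y (x, t) * pExp B (segPoint x y t) y := by
  have h := intervalIntegral.smul_integral_comp_mul_left (a := 0) (b := 1)
    (fun t => segForm B y (x, t) * pExp B (segPoint x y t) y) s
  rw [mul_zero, mul_one] at h
  rw [← h, ← intervalIntegral.integral_smul, pExp_eq_one_sub_integral hB]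
  simp only [segForm_segPoint, segPoint_segPoint, smul_mul_assoc]

theorem pExp_self (y : EuclideanSpace ℝ (Fin d)) : pExp B y y = 1 := by
  rw [pExp_eq_one_sub_integral hB]
  simp [segForm]

theorem hasDerivAt_pExp_segPoint (x y : EuclideanSpace ℝ (Fin d)) (s : ℝ) :
    HasDerivAt (fun s => pExp B (segPoint x y s) y)
      (-(segForm B y (x, s) * pExp B (segPoint x y s) y)) s := by
  have hc : Continuous fun t : ℝ => segForm B y (x, t) * pExp B (segPoint x y t) y := by
    refine ((contDiff_segForm hB y).continuous.comp (by fun_prop)).mul ?_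
    exact (contDiff_pExp hB y).continuous.comp (continuous_segPoint x y)
  have h := (hc.integral_hasStrictDerivAt 0 s).hasDerivAt.const_sub 1
  exact h.congr_of_eventuallyEq (Filter.Eventually.of_forall fun t =>
    pExp_segPoint_eq_one_sub_integral hB x y t)

theorem hasDerivAt_pExp_segPoint_segPoint (x y : EuclideanSpace ℝ (Fin d)) (r t : ℝ) :
    HasDerivAt (fun t => pExp B (segPoint x y t) (segPoint x y r))
      (-(segForm B y (x, t) * pExp B (segPoint x y t) (segPoint x y r))) t := by
  have h := (hasDerivAt_pExp_segPoint hB (segPoint x y r + (x - y)) (segPoint x y r)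
    (t - r)).comp_sub_const t r
  simpa only [segPoint_translate, segForm_translate] using h

omit [CompleteSpace 𝔸] in
theorem eq_of_hasDerivAt_segForm {x y : EuclideanSpace ℝ (Fin d)} {f g : ℝ → 𝔸}
    (hf : ∀ t, HasDerivAt f (-(segForm B y (x, t) * f t)) t)
    (hg : ∀ t, HasDerivAt g (-(segForm B y (x, t) * g t)) t) {r : ℝ} (h : f r = g r) (t : ℝ) :
    f t = g t := by
  -- The interval has both t and r in its interior; on it the compact bound for the connection form
  -- is a Lipschitz constant for the linear ODE.
  obtain ⟨K, hK⟩ := (isCompact_Icc (a := -(|t| + |r| + 1))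
    (b := |t| + |r| + 1)).exists_bound_of_continuousOn (f := fun t => segForm B y (x, t))
    ((contDiff_segForm hB y).continuous.comp (by fun_prop)).continuousOn
  have h1 := abs_le.1 (le_refl |t|)
  have h2 := abs_le.1 (le_refl |r|)
  have h3 := abs_nonneg t
  have h4 := abs_nonneg r
  refine ODE_solution_unique_of_mem_Icc (v := fun t w => -(segForm B y (x, t) * w))
    (s := fun _ => univ) (K := K.toNNReal) (t₀ := r) (a := -(|t| + |r| + 1))
    (b := |t| + |r| + 1) (fun t ht => ?_) ⟨by linarith, by linarith⟩
    (fun t _ => (hf t).continuousAt.continuousWithinAt) (fun t _ => hf t) (fun _ _ => mem_univ _)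
    (fun t _ => (hg t).continuousAt.continuousWithinAt) (fun t _ => hg t) (fun _ _ => mem_univ _)
    h ⟨by linarith, by linarith⟩
  refine LipschitzOnWith.of_dist_le_mul fun u _ w _ => ?_
  rw [dist_neg_neg, dist_eq_norm, dist_eq_norm, ← mul_sub]
  refine (norm_mul_le _ _).trans (mul_le_mul_of_nonneg_right ?_ (norm_nonneg _))
  exact (hK t (Ioo_subset_Icc_self ht)).trans (Real.le_coe_toNNReal K)

/-- As functions of t, both sides solve the same linear transport equation and agree at t = r. -/
theorem pExp_segPoint_mul (x y : EuclideanSpace ℝ (Fin d)) (t r q : ℝ) :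
    pExp B (segPoint x y t) (segPoint x y r) * pExp B (segPoint x y r) (segPoint x y q) =
      pExp B (segPoint x y t) (segPoint x y q) := by
  refine eq_of_hasDerivAt_segForm hB (x := x) (y := y) (r := r)
    (f := fun t => pExp B (segPoint x y t) (segPoint x y r) *
      pExp B (segPoint x y r) (segPoint x y q))
    (g := fun t => pExp B (segPoint x y t) (segPoint x y q)) (fun t => ?_)
    (fun t => hasDerivAt_pExp_segPoint_segPoint hB x y q t) ?_ t
  · have h := (hasDerivAt_pExp_segPoint_segPoint hB x y r t).mul_const
      (pExp B (segPoint x y r) (segPoint x y q))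
    rwa [neg_mul, mul_assoc] at h
  · simp only [pExp_self hB, one_mul]

theorem pExp_mul_pExp_symm (x y : EuclideanSpace ℝ (Fin d)) : pExp B x y * pExp B y x = 1 := by
  simpa only [segPoint_zero, segPoint_one, pExp_self hB] using pExp_segPoint_mul hB x y 1 0 1

/-- The path-ordered exponential as a unit; its inverse is the one of the reversed segment. -/
def pExpUnit (x y : EuclideanSpace ℝ (Fin d)) : 𝔸ˣ where
  val := pExp B x y
  inv := pExp B y x
  val_inv := pExp_mul_pExp_symm hB x y
  inv_val := pExp_mul_pExp_symm hB y x

theorem inverse_pExp (x y : EuclideanSpace ℝ (Fin d)) :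
    Ring.inverse (pExp B x y) = pExp B y x :=
  Ring.inverse_unit (pExpUnit hB x y)

theorem contDiff_pExp_right (x : EuclideanSpace ℝ (Fin d)) :
    ContDiff ℝ ∞ (fun y => pExp B x y) := by
  simp only [← inverse_pExp hB _ x]
  rw [contDiff_iff_contDiffAt]
  intro y
  exact ContDiffAt.comp y (g := Ring.inverse) (f := fun y => pExp B y x)
    (contDiffAt_ringInverse ℝ (pExpUnit hB y x)) (contDiff_pExp hB x).contDiffAt

theorem pExp_segPoint_right (x y : EuclideanSpace ℝ (Fin d)) (s : ℝ) :
    pExp B x (segPoint x y s) = pExp B x y * pExp B y (segPoint x y s) := by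
  simpa only [segPoint_zero, segPoint_one] using (pExp_segPoint_mul hB x y 1 0 s).symm

end PathOrderedExponential

/-! ### The recursion solves the transport system. -/

section Solution

variable {B : Fin d → EuclideanSpace ℝ (Fin d) → 𝔸}

theorem sum_smul_covDeriv (f : EuclideanSpace ℝ (Fin d) → 𝔸) (x y : EuclideanSpace ℝ (Fin d)) :
    ∑ μ, (x μ - y μ) • covDeriv B μ f x =
      ∑ μ, (x μ - y μ) • partialDeriv μ f x + segForm B y (x, 1) * f x := by
  simp only [covDeriv, segForm, segPoint_one, smul_add, Finset.sum_add_distrib, Finset.sum_mul,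
    smul_mul_assoc]

theorem sum_smul_covDeriv_eq {f : EuclideanSpace ℝ (Fin d) → 𝔸} (hf : ContDiff ℝ ∞ f)
    {x y : EuclideanSpace ℝ (Fin d)} {f' : 𝔸}
    (h : HasDerivAt (fun t => f (segPoint x y t)) f' 1) :
    ∑ μ, (x μ - y μ) • covDeriv B μ f x = f' + segForm B y (x, 1) * f x := by
  have h1 := (hasDerivAt_comp_segPoint hf x y 1).unique h
  rw [segPoint_one] at h1
  rw [sum_smul_covDeriv, h1]

variable [CompleteSpace 𝔸]

omit [CompleteSpace 𝔸] in
theorem contDiff_integral_pow_smul_segPoint {h : EuclideanSpace ℝ (Fin d) → 𝔸}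
    (hh : ContDiff ℝ ∞ h) (n : ℕ) (y : EuclideanSpace ℝ (Fin d)) :
    ContDiff ℝ ∞ (fun x => ∫ s in (0 : ℝ)..1, s ^ n • h (segPoint x y s)) := by
  refine contDiff_integral_unit
    (f := fun p : EuclideanSpace ℝ (Fin d) × ℝ => p.2 ^ n • h (segPoint p.1 y p.2)) ?_
  exact (contDiff_snd.pow n).smul (hh.comp (contDiff_segPoint y))

/-- With k the integral as a function of the endpoint, substitution gives t ^ (n + 1) k(z(t)) = ∫₀ᵗ
s ^ n h(z(s)) ds. As k is already known to be smooth, differentiating both sides at t = 1 isolates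
its derivative without dividing by t. -/
theorem hasDerivAt_integral_pow_smul_segPoint {h : EuclideanSpace ℝ (Fin d) → 𝔸}
    (hh : ContDiff ℝ ∞ h) (n : ℕ) (x y : EuclideanSpace ℝ (Fin d)) :
    HasDerivAt (fun t => ∫ s in (0 : ℝ)..1, s ^ n • h (segPoint (segPoint x y t) y s))
      (h x - ((n : ℝ) + 1) • ∫ s in (0 : ℝ)..1, s ^ n • h (segPoint x y s)) 1 := by
  have hk := contDiff_integral_pow_smul_segPoint hh n y
  have h1 := hasDerivAt_comp_segPoint hk x y 1
  have h2 := (hasDerivAt_pow (n + 1) (1 : ℝ)).smul h1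
  have hc : Continuous fun s : ℝ => s ^ n • h (segPoint x y s) :=
    (continuous_pow n).smul (hh.continuous.comp (continuous_segPoint x y))
  have h3 := (hc.integral_hasStrictDerivAt 0 1).hasDerivAt
  have e : (fun t : ℝ => ∫ s in (0 : ℝ)..t, s ^ n • h (segPoint x y s)) =
      fun t : ℝ => t ^ (n + 1) •
        ∫ s in (0 : ℝ)..1, s ^ n • h (segPoint (segPoint x y t) y s) := by
    funext t
    have h4 := intervalIntegral.smul_integral_comp_mul_left (a := 0) (b := 1)
      (fun s : ℝ => s ^ n • h (segPoint x y s)) t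
    rw [mul_zero, mul_one] at h4
    rw [← h4, pow_succ', mul_smul, ← intervalIntegral.integral_smul (t ^ n)]
    simp only [segPoint_segPoint, mul_pow, mul_smul]
  rw [e] at h3
  have h5 := h2.unique h3
  simp only [one_pow, one_smul, mul_one, segPoint_one] at h5
  rw [segPoint_one] at h1
  convert h1 using 1
  rw [← h5]
  push_cast
  abel

variable (hB : ∀ μ, ContDiff ℝ ∞ (B μ))
include hB

/-- The factorisation Φ(x, z(s)) = Φ(x, y) Φ(y, z(s)) leaves under the integral a function that
depends on x only through z(s). -/
theorem seeleyDeWitt_succ {n : ℕ} {y : EuclideanSpace ℝ (Fin d)}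
    (h : ContDiff ℝ ∞ (fun x => seeleyDeWitt B n x y)) (x : EuclideanSpace ℝ (Fin d)) :
    seeleyDeWitt B (n + 1) x y = -(pExp B x y * ∫ s in (0 : ℝ)..1,
      s ^ n • (fun z => pExp B y z * covLaplace B (fun z => seeleyDeWitt B n z y) z)
        (segPoint x y s)) := by
  have hc : Continuous fun s : ℝ => s ^ n •
      (fun z => pExp B y z * covLaplace B (fun z => seeleyDeWitt B n z y) z) (segPoint x y s) :=
    (continuous_pow n).smul (((contDiff_pExp_right hB y).mul
      (contDiff_covLaplace hB h)).continuous.comp (continuous_segPoint x y))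
  have e := (ContinuousLinearMap.mul ℝ 𝔸 (pExp B x y)).intervalIntegral_comp_comm
    (hc.intervalIntegrable (μ := MeasureTheory.volume) 0 1)
  simp only [ContinuousLinearMap.mul_apply'] at e
  rw [← e]
  simp only [seeleyDeWitt, pExp_segPoint_right hB x y, mul_assoc, mul_smul_comm]

theorem isClassicalSolution_seeleyDeWitt : IsClassicalSolution B (seeleyDeWitt B) := by
  have smooth : ∀ n y, ContDiff ℝ ∞ (fun x => seeleyDeWitt B n x y) := by
    intro n y
    induction n with
    | zero => exact contDiff_pExp hB y
    | succ n ih =>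
      simp only [seeleyDeWitt_succ hB ih]
      exact ((contDiff_pExp hB y).mul (contDiff_integral_pow_smul_segPoint
        ((contDiff_pExp_right hB y).mul (contDiff_covLaplace hB ih)) n y)).neg
  refine ⟨smooth, pExp_self hB, fun x y => ?_, fun n x y => ?_⟩
  · have h := hasDerivAt_pExp_segPoint hB x y 1
    rw [segPoint_one] at h
    rw [sum_smul_covDeriv_eq (smooth 0 y) h]
    exact neg_add_cancel _
  · have hh := (contDiff_pExp_right hB y).mul (contDiff_covLaplace hB (smooth n y))
    -- In the product rule, the derivative of Φ cancels the connection term of the radial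
    -- derivative; the derivative of the integral cancels (n + 1) a_{n+1} and leaves -A₁ a_n,
    -- because Φ(x, y) Φ(y, x) = 1.
    have h := ((hasDerivAt_pExp_segPoint hB x y 1).mul
      (hasDerivAt_integral_pow_smul_segPoint hh n x y)).neg
    have h' : HasDerivAt (fun t => seeleyDeWitt B (n + 1) (segPoint x y t) y) _ 1 :=
      h.congr_of_eventuallyEq (Filter.Eventually.of_forall fun t => seeleyDeWitt_succ hB (smooth n y) _)
    rw [sum_smul_covDeriv_eq (smooth (n + 1) y) h', seeleyDeWitt_succ hB (smooth n y)]
    simp only [segPoint_one, mul_sub, ← mul_assoc, pExp_mul_pExp_symm hB, one_mul, mul_smul_comm,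
      smul_neg, neg_mul, mul_neg]
    abel

end Solution

end HeatKernel

end

noncomputable section

namespace HeatKernel

variable {d : ℕ} {𝔸 : Type*} [NormedRing 𝔸] [NormedAlgebra ℝ 𝔸]

/-! ### Leibniz rules and curvature as a commutator. -/

section PointwiseIdentities

theorem partialDeriv_add {f g : EuclideanSpace ℝ (Fin d) → 𝔸} (hf : ContDiff ℝ ∞ f)
    (hg : ContDiff ℝ ∞ g) (μ : Fin d) :
    partialDeriv μ (f + g) = partialDeriv μ f + partialDeriv μ g := by
  funext x
  simp only [partialDeriv, Pi.add_apply]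
  rw [fderiv_add (hf.differentiable (by simp) x) (hg.differentiable (by simp) x)]
  rfl

theorem partialDeriv_smul {f : EuclideanSpace ℝ (Fin d) → 𝔸} (hf : ContDiff ℝ ∞ f) (c : ℝ)
    (μ : Fin d) : partialDeriv μ (c • f) = c • partialDeriv μ f := by
  funext x
  simp only [partialDeriv, Pi.smul_apply]
  rw [fderiv_const_smul (hf.differentiable (by simp) x)]
  rfl

theorem partialDeriv_mul {f g : EuclideanSpace ℝ (Fin d) → 𝔸} (hf : ContDiff ℝ ∞ f)
    (hg : ContDiff ℝ ∞ g) (μ : Fin d) :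
    partialDeriv μ (f * g) = partialDeriv μ f * g + f * partialDeriv μ g := by
  funext x
  simp only [partialDeriv, Pi.add_apply, Pi.mul_apply]
  rw [fderiv_mul' (hf.differentiable (by simp) x) (hg.differentiable (by simp) x)]
  simp [add_comm]

theorem partialDeriv_coord_smul {f : EuclideanSpace ℝ (Fin d) → 𝔸} (hf : ContDiff ℝ ∞ f)
    (y : EuclideanSpace ℝ (Fin d)) (μ ν : Fin d) :
    partialDeriv μ (fun x => (x ν - y ν) • f x) =
      fun x => (x ν - y ν) • partialDeriv μ f x + (if μ = ν then (1 : ℝ) else 0) • f x := by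
  funext x
  have hc : HasFDerivAt (fun x : EuclideanSpace ℝ (Fin d) => x ν - y ν)
      (EuclideanSpace.proj ν : EuclideanSpace ℝ (Fin d) →L[ℝ] ℝ) x :=
    (EuclideanSpace.proj ν : EuclideanSpace ℝ (Fin d) →L[ℝ] ℝ).hasFDerivAt.sub_const _
  have h : fderiv ℝ (fun x : EuclideanSpace ℝ (Fin d) => (x ν - y ν) • f x) x = _ :=
    (hc.smul (hf.differentiable (by simp) x).hasFDerivAt).fderiv
  simp only [partialDeriv]
  rw [h]
  simp [eq_comm]

theorem partialDeriv_comm {f : EuclideanSpace ℝ (Fin d) → 𝔸} (hf : ContDiff ℝ ∞ f)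
    (μ ν : Fin d) : partialDeriv μ (partialDeriv ν f) = partialDeriv ν (partialDeriv μ f) := by
  have key : ∀ (μ ν : Fin d) (x : EuclideanSpace ℝ (Fin d)),
      partialDeriv μ (partialDeriv ν f) x =
        fderiv ℝ (fderiv ℝ f) x (EuclideanSpace.single μ 1) (EuclideanSpace.single ν 1) := by
    intro μ ν x
    have h : DifferentiableAt ℝ (fderiv ℝ f) x :=
      (hf.fderiv_right (m := ∞) (by simp)).differentiable (by simp) x
    unfold partialDeriv
    rw [fderiv_clm_apply h (differentiableAt_const _)]
    simp
  funext x
  rw [key, key]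
  exact (hf.contDiffAt.isSymmSndFDerivAt
    (by simpa using ENat.LEInfty.out (m := 2))).eq _ _

variable {B : Fin d → EuclideanSpace ℝ (Fin d) → 𝔸}

theorem covDeriv_mul {f g : EuclideanSpace ℝ (Fin d) → 𝔸} (hf : ContDiff ℝ ∞ f)
    (hg : ContDiff ℝ ∞ g) (μ : Fin d) :
    covDeriv B μ (f * g) = adjDeriv B μ f * g + f * covDeriv B μ g := by
  funext x
  simp only [covDeriv, adjDeriv, partialDeriv_mul hf hg, Pi.add_apply, Pi.mul_apply,
    Ring.lie_def]
  noncomm_ring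

theorem covDeriv_covDeriv (hB : ∀ μ, ContDiff ℝ ∞ (B μ))
    {f : EuclideanSpace ℝ (Fin d) → 𝔸} (hf : ContDiff ℝ ∞ f) (μ ν : Fin d) :
    covDeriv B μ (covDeriv B ν f) = partialDeriv μ (partialDeriv ν f) +
      (partialDeriv μ (B ν) * f + B ν * partialDeriv μ f + B μ * partialDeriv ν f +
        B μ * (B ν * f)) := by
  funext x
  have h : covDeriv B ν f = partialDeriv ν f + B ν * f := rfl
  have h' : ∀ g, covDeriv B μ g x = partialDeriv μ g x + B μ x * g x := fun _ => rfl
  rw [h', h, partialDeriv_add (contDiff_partialDeriv hf ν) (g := B ν * f) ((hB ν).mul hf),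
    partialDeriv_mul (hB ν) hf]
  simp only [Pi.add_apply, Pi.mul_apply]
  noncomm_ring

theorem fieldStrength_mul (hB : ∀ μ, ContDiff ℝ ∞ (B μ))
    {f : EuclideanSpace ℝ (Fin d) → 𝔸} (hf : ContDiff ℝ ∞ f) (μ ν : Fin d) :
    fieldStrength B μ ν * f = covDeriv B μ (covDeriv B ν f) - covDeriv B ν (covDeriv B μ f) := by
  rw [covDeriv_covDeriv hB hf, covDeriv_covDeriv hB hf, partialDeriv_comm hf μ ν]
  funext x
  simp only [fieldStrength, Pi.add_apply, Pi.sub_apply, Pi.mul_apply, Ring.lie_def]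
  noncomm_ring

end PointwiseIdentities

/-! ### Covariant derivatives and coordinates as operators on smooth functions. -/

section OperatorAlgebra

/-- The algebra of smooth functions on `ℝ^d`. -/
def smoothFunctions (d : ℕ) (𝔸 : Type*) [NormedRing 𝔸] [NormedAlgebra ℝ 𝔸] :
    Subalgebra ℝ (EuclideanSpace ℝ (Fin d) → 𝔸) where
  carrier := {f | ContDiff ℝ ∞ f}
  mul_mem' hf hg := Set.mem_ofPred.2 ((Set.mem_ofPred.1 hf).mul (Set.mem_ofPred.1 hg))
  add_mem' hf hg := Set.mem_ofPred.2 ((Set.mem_ofPred.1 hf).add (Set.mem_ofPred.1 hg))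
  algebraMap_mem' _ := Set.mem_ofPred.2 contDiff_const

theorem mem_smoothFunctions {f : EuclideanSpace ℝ (Fin d) → 𝔸} :
    f ∈ smoothFunctions d 𝔸 ↔ ContDiff ℝ ∞ f := Iff.rfl

theorem contDiff_coe (f : smoothFunctions d 𝔸) : ContDiff ℝ ∞ f.1 :=
  mem_smoothFunctions.1 f.2

/-- Evaluation of smooth functions at a point. -/
def evalAt (y : EuclideanSpace ℝ (Fin d)) : smoothFunctions d 𝔸 →ₐ[ℝ] 𝔸 :=
  (Pi.evalAlgHom ℝ (fun _ : EuclideanSpace ℝ (Fin d) => 𝔸) y).comp (smoothFunctions d 𝔸).val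

/-- Multiplication by the coordinate `(x - y)^ν`, as an operator on smooth functions. -/
def coordOp (y : EuclideanSpace ℝ (Fin d)) (ν : Fin d) :
    smoothFunctions d 𝔸 →ₗ[ℝ] smoothFunctions d 𝔸 where
  toFun f := ⟨fun x => (x ν - y ν) • f.1 x, mem_smoothFunctions.2 <|
    ContDiff.smul (f := fun x : EuclideanSpace ℝ (Fin d) => x ν - y ν) (by fun_prop)
      (contDiff_coe f)⟩
  map_add' f g := Subtype.ext (funext fun x => smul_add _ _ _)
  map_smul' c f := Subtype.ext (funext fun x => smul_comm _ _ _)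

theorem evalAt_coordOp (y : EuclideanSpace ℝ (Fin d)) (ν : Fin d) (f : smoothFunctions d 𝔸) :
    evalAt y (coordOp y ν f) = 0 := by
  change (y ν - y ν) • f.1 y = 0
  simp

variable {B : Fin d → EuclideanSpace ℝ (Fin d) → 𝔸} (hB : ∀ μ, ContDiff ℝ ∞ (B μ))

/-- The covariant derivative as an operator on smooth functions. -/
def covOp (μ : Fin d) : smoothFunctions d 𝔸 →ₗ[ℝ] smoothFunctions d 𝔸 where
  toFun f := ⟨covDeriv B μ f.1, mem_smoothFunctions.2 (contDiff_covDeriv hB (contDiff_coe f) μ)⟩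
  map_add' f g := by
    ext x
    change partialDeriv μ (f.1 + g.1) x + B μ x * (f.1 x + g.1 x) =
      (partialDeriv μ f.1 x + B μ x * f.1 x) + (partialDeriv μ g.1 x + B μ x * g.1 x)
    rw [partialDeriv_add (contDiff_coe f) (contDiff_coe g), Pi.add_apply, mul_add]
    abel
  map_smul' c f := by
    ext x
    change partialDeriv μ (c • f.1) x + B μ x * (c • f.1 x) =
      c • (partialDeriv μ f.1 x + B μ x * f.1 x)
    rw [partialDeriv_smul (contDiff_coe f), Pi.smul_apply, mul_smul_comm, smul_add]

theorem covOp_coordOp (y : EuclideanSpace ℝ (Fin d)) (μ ν : Fin d) (f : smoothFunctions d 𝔸) :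
    covOp hB μ (coordOp y ν f) =
      coordOp y ν (covOp hB μ f) + (if μ = ν then (1 : ℝ) else 0) • f := by
  ext x
  change partialDeriv μ (fun x => (x ν - y ν) • f.1 x) x + B μ x * ((x ν - y ν) • f.1 x) =
    (x ν - y ν) • (partialDeriv μ f.1 x + B μ x * f.1 x) +
      (if μ = ν then (1 : ℝ) else 0) • f.1 x
  rw [partialDeriv_coord_smul (contDiff_coe f), mul_smul_comm, smul_add, add_right_comm]

/-- The radial operator `(x - y)^μ D_μ` on smooth functions. -/
def radialOp (y : EuclideanSpace ℝ (Fin d)) :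
    smoothFunctions d 𝔸 →ₗ[ℝ] smoothFunctions d 𝔸 :=
  ∑ μ, coordOp y μ ∘ₗ covOp hB μ

theorem covOp_radialOp (y : EuclideanSpace ℝ (Fin d)) (μ : Fin d) (f : smoothFunctions d 𝔸) :
    covOp hB μ (radialOp hB y f) =
      ∑ ν, coordOp y ν (covOp hB μ (covOp hB ν f)) + covOp hB μ f := by
  simp [radialOp, covOp_coordOp, Finset.sum_add_distrib]

/-- The field strength as a smooth function. -/
def curv (μ ν : Fin d) : smoothFunctions d 𝔸 :=
  ⟨fieldStrength B μ ν, mem_smoothFunctions.2 (contDiff_fieldStrength hB μ ν)⟩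

/-- The adjoint covariant derivative of a smooth function. -/
def adjOp (μ : Fin d) (f : smoothFunctions d 𝔸) : smoothFunctions d 𝔸 :=
  ⟨adjDeriv B μ f.1, mem_smoothFunctions.2 (contDiff_adjDeriv hB (contDiff_coe f) μ)⟩

theorem curv_mul (μ ν : Fin d) (f : smoothFunctions d 𝔸) :
    curv hB μ ν * f = covOp hB μ (covOp hB ν f) - covOp hB ν (covOp hB μ f) :=
  Subtype.ext (fieldStrength_mul hB (contDiff_coe f) μ ν)

theorem adjOp_mul (μ : Fin d) (f g : smoothFunctions d 𝔸) :
    adjOp hB μ f * g = covOp hB μ (f * g) - f * covOp hB μ g :=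
  eq_sub_of_add_eq (Subtype.ext (covDeriv_mul (contDiff_coe f) (contDiff_coe g) μ)).symm

end OperatorAlgebra

/-! ### Words in the covariant derivatives applied to the radial operator, at the base point. -/

section Diagonal

variable {B : Fin d → EuclideanSpace ℝ (Fin d) → 𝔸} (hB : ∀ μ, ContDiff ℝ ∞ (B μ))

/-- Commuting the coordinate factor to the front produces one Kronecker term per letter passed; the
term that still carries the coordinate vanishes at y. -/
theorem evalAt_radialOp_two (y : EuclideanSpace ℝ (Fin d)) (i j : Fin d)
    (f : smoothFunctions d 𝔸) :
    evalAt y (covOp hB i (covOp hB j (radialOp hB y f))) =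
      evalAt y (covOp hB j (covOp hB i f)) + evalAt y (covOp hB i (covOp hB j f)) := by
  simp [covOp_radialOp, covOp_coordOp, evalAt_coordOp, Finset.sum_add_distrib]

theorem evalAt_radialOp_four (y : EuclideanSpace ℝ (Fin d)) (i j k l : Fin d)
    (f : smoothFunctions d 𝔸) :
    evalAt y (covOp hB i (covOp hB j (covOp hB k (covOp hB l (radialOp hB y f))))) =
      evalAt y (covOp hB j (covOp hB k (covOp hB l (covOp hB i f)))) +
      evalAt y (covOp hB i (covOp hB k (covOp hB l (covOp hB j f)))) +
      evalAt y (covOp hB i (covOp hB j (covOp hB l (covOp hB k f)))) +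
      evalAt y (covOp hB i (covOp hB j (covOp hB k (covOp hB l f)))) := by
  simp [covOp_radialOp, covOp_coordOp, evalAt_coordOp, Finset.sum_add_distrib]

theorem evalAt_radialOp_six (y : EuclideanSpace ℝ (Fin d)) (i j k l m n : Fin d)
    (f : smoothFunctions d 𝔸) :
    evalAt y (covOp hB i (covOp hB j (covOp hB k (covOp hB l (covOp hB m (covOp hB n
        (radialOp hB y f))))))) =
      evalAt y (covOp hB j (covOp hB k (covOp hB l (covOp hB m (covOp hB n (covOp hB i f)))))) +
      evalAt y (covOp hB i (covOp hB k (covOp hB l (covOp hB m (covOp hB n (covOp hB j f)))))) +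
      evalAt y (covOp hB i (covOp hB j (covOp hB l (covOp hB m (covOp hB n (covOp hB k f)))))) +
      evalAt y (covOp hB i (covOp hB j (covOp hB k (covOp hB m (covOp hB n (covOp hB l f)))))) +
      evalAt y (covOp hB i (covOp hB j (covOp hB k (covOp hB l (covOp hB n (covOp hB m f)))))) +
      evalAt y (covOp hB i (covOp hB j (covOp hB k (covOp hB l (covOp hB m (covOp hB n f)))))) := by
  simp [covOp_radialOp, covOp_coordOp, evalAt_coordOp, Finset.sum_add_distrib]

end Diagonal

end HeatKernel

end

noncomputable section

namespace HeatKernel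

variable {d : ℕ} {𝔸 : Type*} [NormedRing 𝔸] [NormedAlgebra ℝ 𝔸]

/-! ### Linear algebra of fully contracted words. -/

section ContractedWords

variable {B : Fin d → EuclideanSpace ℝ (Fin d) → 𝔸} (hB : ∀ μ, ContDiff ℝ ∞ (B μ))
  (y : EuclideanSpace ℝ (Fin d))

theorem evalAt_radialOp (f : smoothFunctions d 𝔸) : evalAt y (radialOp hB y f) = 0 := by
  simp [radialOp, evalAt_coordOp]

/-- This and the following renamings of dummy indices bring every contracted word to a normal form,
its indices named in order of first appearance, so that equal words become identical terms. -/
theorem sum_two_rename (t : Fin d → Fin d → smoothFunctions d 𝔸) :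
    ∑ a, ∑ b, evalAt y (covOp hB b (t a b)) = ∑ a, ∑ b, evalAt y (covOp hB a (t b a)) :=
  Finset.sum_comm

theorem sum_three_rename_fst_snd (t : Fin d → Fin d → Fin d → smoothFunctions d 𝔸) :
    ∑ a, ∑ b, ∑ c, evalAt y (covOp hB b (t a b c)) =
      ∑ a, ∑ b, ∑ c, evalAt y (covOp hB a (t b a c)) :=
  Finset.sum_comm

theorem sum_three_rename_fst_trd (t : Fin d → Fin d → Fin d → smoothFunctions d 𝔸) :
    ∑ a, ∑ b, ∑ c, evalAt y (covOp hB c (t a b c)) =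
      ∑ a, ∑ b, ∑ c, evalAt y (covOp hB a (t b c a)) := by
  rw [Finset.sum_comm_cycle]

theorem sum_three_rename_snd_trd (t : Fin d → Fin d → Fin d → smoothFunctions d 𝔸) :
    ∑ a, ∑ b, ∑ c, evalAt y (covOp hB a (covOp hB c (t a b c))) =
      ∑ a, ∑ b, ∑ c, evalAt y (covOp hB a (covOp hB b (t a c b))) :=
  Finset.sum_congr rfl fun _ _ => Finset.sum_comm

theorem sum_three_rename_snd_trd' (t : Fin d → Fin d → Fin d → smoothFunctions d 𝔸) :
    ∑ a, ∑ b, ∑ c, evalAt y (covOp hB a (covOp hB a (covOp hB c (t a b c)))) =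
      ∑ a, ∑ b, ∑ c, evalAt y (covOp hB a (covOp hB a (covOp hB b (t a c b)))) :=
  Finset.sum_congr rfl fun _ _ => Finset.sum_comm

/-- Write W₁, W₂, W₃ for the contracted words μμνν, μννμ, μνμν on f. On g they equal 3W₁ + 2W₂, W₁ +
2W₂ + 2W₃ and W₁ + W₂ + 3W₃; the weights 4, -6, 4 eliminate W₂ and W₃. -/
theorem sum_sum_evalAt_covOp_of_radialOp {f g : smoothFunctions d 𝔸}
    (h : f + radialOp hB y f = g) :
    (10 : ℝ) • ∑ μ, ∑ ν, evalAt y (covOp hB μ (covOp hB μ (covOp hB ν (covOp hB ν f)))) =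
      (4 : ℝ) • ∑ μ, ∑ ν, evalAt y (covOp hB μ (covOp hB μ (covOp hB ν (covOp hB ν g)))) -
      (6 : ℝ) • ∑ μ, ∑ ν, evalAt y (covOp hB μ (covOp hB ν (covOp hB ν (covOp hB μ g)))) +
      (4 : ℝ) • ∑ μ, ∑ ν, evalAt y (covOp hB μ (covOp hB ν (covOp hB μ (covOp hB ν g)))) := by
  subst h
  simp only [map_add, evalAt_radialOp_four, Finset.sum_add_distrib, sum_two_rename]
  module

theorem evalAt_third_coefficient {a : ℕ → smoothFunctions d 𝔸}
    (h : ∀ n : ℕ, ((n : ℝ) + 1) • a (n + 1) + radialOp hB y (a (n + 1)) =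
      ∑ μ, covOp hB μ (covOp hB μ (a n))) :
    evalAt y (a 3) =
      (1 / 30 : ℝ) • ∑ μ, ∑ ν, ∑ ρ, evalAt y (covOp hB μ (covOp hB μ (covOp hB ν (covOp hB ν
        (covOp hB ρ (covOp hB ρ (a 0))))))) -
      (1 / 20 : ℝ) • ∑ μ, ∑ ν, ∑ ρ, evalAt y (covOp hB μ (covOp hB ν (covOp hB ν (covOp hB μ
        (covOp hB ρ (covOp hB ρ (a 0))))))) +
      (1 / 30 : ℝ) • ∑ μ, ∑ ν, ∑ ρ, evalAt y (covOp hB μ (covOp hB ν (covOp hB μ (covOp hB ν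
        (covOp hB ρ (covOp hB ρ (a 0))))))) := by
  have h3 := congrArg (evalAt y) (h 2)
  simp only [map_add, map_smul, map_sum, evalAt_radialOp, add_zero] at h3
  have h2 := congrArg (fun f => ∑ μ, evalAt y (covOp hB μ (covOp hB μ f))) (h 1)
  simp only [map_add, map_smul, map_sum, evalAt_radialOp_two, Finset.sum_add_distrib,
    ← Finset.smul_sum] at h2
  have h0 := h 0
  rw [Nat.cast_zero, zero_add, one_smul] at h0
  have h1 := sum_sum_evalAt_covOp_of_radialOp hB y h0
  simp only [map_sum] at h1
  push_cast at h2 h3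
  norm_num at h2 h3 h1
  -- The three levels contribute the factors 3, 4 = 2 + 2 (the two letters of the Laplacian passing
  -- the radial operator) and 10; the weights are the successive inverse products.
  linear_combination (norm := module) (1 / 3 : ℝ) • h3 + (1 / 12 : ℝ) • h2 + (1 / 120 : ℝ) • h1

-- Both sides become combinations of contracted six-letter words on f. They differ by a combination
-- of the relations obtained by applying such words to R f = 0. Keeping f as rightmost factor lets
-- curvatures be replaced by commutators of operators.
set_option maxHeartbeats 1000000 in
theorem contracted_words_eq {f : smoothFunctions d 𝔸} (h : radialOp hB y f = 0) :
    (1 / 30 : ℝ) • ∑ μ, ∑ ν, ∑ ρ, evalAt y (covOp hB μ (covOp hB μ (covOp hB ν (covOp hB ν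
        (covOp hB ρ (covOp hB ρ f)))))) -
      (1 / 20 : ℝ) • ∑ μ, ∑ ν, ∑ ρ, evalAt y (covOp hB μ (covOp hB ν (covOp hB ν (covOp hB μ
        (covOp hB ρ (covOp hB ρ f)))))) +
      (1 / 30 : ℝ) • ∑ μ, ∑ ν, ∑ ρ, evalAt y (covOp hB μ (covOp hB ν (covOp hB μ (covOp hB ν
        (covOp hB ρ (covOp hB ρ f)))))) =
    (1 / 45 : ℝ) • ∑ μ, ∑ τ, ∑ ν, evalAt y
        (adjOp hB μ (curv hB τ ν) * (adjOp hB μ (curv hB τ ν) * f)) +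
      (1 / 180 : ℝ) • ∑ μ, ∑ τ, ∑ ν, evalAt y
        (adjOp hB μ (curv hB μ ν) * (adjOp hB τ (curv hB τ ν) * f)) +
      (1 / 60 : ℝ) • ∑ μ, ∑ τ, ∑ ν, evalAt y
        (curv hB τ ν * (adjOp hB μ (adjOp hB μ (curv hB τ ν)) * f) +
          adjOp hB μ (adjOp hB μ (curv hB τ ν)) * (curv hB τ ν * f)) -
      (1 / 30 : ℝ) • ∑ μ, ∑ τ, ∑ ν, evalAt y
        (curv hB τ μ * (curv hB μ ν * (curv hB ν τ * f))) := by
  have key : ∀ i j k l m n, evalAt y (covOp hB i (covOp hB j (covOp hB k (covOp hB l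
      (covOp hB m (covOp hB n (radialOp hB y f))))))) = 0 := by
    intros
    simp only [h, map_zero]
  simp only [evalAt_radialOp_six] at key
  have r₁ : ∑ μ, ∑ ν, ∑ ρ, _ = ∑ μ : Fin d, ∑ ν : Fin d, ∑ ρ : Fin d, (0 : 𝔸) :=
    Finset.sum_congr rfl fun μ _ => Finset.sum_congr rfl fun ν _ => Finset.sum_congr rfl
      fun ρ _ => key μ μ ν ν ρ ρ
  have r₂ : ∑ μ, ∑ ν, ∑ ρ, _ = ∑ μ : Fin d, ∑ ν : Fin d, ∑ ρ : Fin d, (0 : 𝔸) :=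
    Finset.sum_congr rfl fun μ _ => Finset.sum_congr rfl fun ν _ => Finset.sum_congr rfl
      fun ρ _ => key μ ν μ ρ ν ρ
  have r₃ : ∑ μ, ∑ ν, ∑ ρ, _ = ∑ μ : Fin d, ∑ ν : Fin d, ∑ ρ : Fin d, (0 : 𝔸) :=
    Finset.sum_congr rfl fun μ _ => Finset.sum_congr rfl fun ν _ => Finset.sum_congr rfl
      fun ρ _ => key μ ν ρ μ ν ρ
  have r₄ : ∑ μ, ∑ ν, ∑ ρ, _ = ∑ μ : Fin d, ∑ ν : Fin d, ∑ ρ : Fin d, (0 : 𝔸) :=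
    Finset.sum_congr rfl fun μ _ => Finset.sum_congr rfl fun ν _ => Finset.sum_congr rfl
      fun ρ _ => key μ ν ρ ρ μ ν
  have r₅ : ∑ μ, ∑ ν, ∑ ρ, _ = ∑ μ : Fin d, ∑ ν : Fin d, ∑ ρ : Fin d, (0 : 𝔸) :=
    Finset.sum_congr rfl fun μ _ => Finset.sum_congr rfl fun ν _ => Finset.sum_congr rfl
      fun ρ _ => key μ ν ρ ρ ν μ
  simp only [Finset.sum_add_distrib, Finset.sum_const_zero, sum_three_rename_fst_snd,
    sum_three_rename_snd_trd, sum_three_rename_snd_trd']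
    at r₁ r₂ r₃ r₄ r₅
  simp only [adjOp_mul, curv_mul, map_add, map_sub, Finset.sum_add_distrib,
    Finset.sum_sub_distrib, sum_three_rename_fst_snd,
    sum_three_rename_fst_trd, sum_three_rename_snd_trd, sum_three_rename_snd_trd']
  -- The weights solve the linear system that compares the coefficients of the contracted words,
  -- treated as independent atoms.
  linear_combination (norm := module) (1 / 72 : ℝ) • r₁ - (1 / 45 : ℝ) • r₂ + (1 / 30 : ℝ) • r₃ -
    (1 / 36 : ℝ) • r₄ + (1 / 180 : ℝ) • r₅

end ContractedWords

theorem thirdCoefficient_diagonal {B : Fin d → EuclideanSpace ℝ (Fin d) → 𝔸}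
    (hB : ∀ μ, ContDiff ℝ ∞ (B μ))
    {a : ℕ → EuclideanSpace ℝ (Fin d) → EuclideanSpace ℝ (Fin d) → 𝔸}
    (ha : IsClassicalSolution B a) (x : EuclideanSpace ℝ (Fin d)) :
    a 3 x x =
      (1 / 45 : ℝ) • ∑ μ, ∑ τ, ∑ ν,
          adjDeriv B μ (fieldStrength B τ ν) x * adjDeriv B μ (fieldStrength B τ ν) x
      + (1 / 180 : ℝ) • ∑ μ, ∑ τ, ∑ ν,
          adjDeriv B μ (fieldStrength B μ ν) x * adjDeriv B τ (fieldStrength B τ ν) x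
      + (1 / 60 : ℝ) • ∑ μ, ∑ τ, ∑ ν,
          (fieldStrength B τ ν x * adjDeriv B μ (adjDeriv B μ (fieldStrength B τ ν)) x
            + adjDeriv B μ (adjDeriv B μ (fieldStrength B τ ν)) x * fieldStrength B τ ν x)
      - (1 / 30 : ℝ) • ∑ μ, ∑ τ, ∑ ν,
          fieldStrength B τ μ x * fieldStrength B μ ν x * fieldStrength B ν τ x := by
  -- The diagonal point serves as base point: the second argument is frozen at x, and evaluation
  -- there turns a_0 into 1.
  let α : ℕ → smoothFunctions d 𝔸 := fun n =>
    ⟨fun z => a n z x, mem_smoothFunctions.2 (ha.smooth n x)⟩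
  have hrad : ∀ (f : smoothFunctions d 𝔸) z, (radialOp hB x f).1 z =
      ∑ μ, (z μ - x μ) • covDeriv B μ f.1 z := by
    intro f z
    simp only [radialOp, LinearMap.sum_apply, AddSubmonoidClass.coe_finsetSum, Finset.sum_apply]
    rfl
  have h0 : radialOp hB x (α 0) = 0 := by
    ext z
    exact (hrad _ z).trans (ha.transport_zero z x)
  have hs : ∀ n : ℕ, ((n : ℝ) + 1) • α (n + 1) + radialOp hB x (α (n + 1)) =
      ∑ μ, covOp hB μ (covOp hB μ (α n)) := by
    intro n
    ext z
    have h := ha.transport_succ n z x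
    rw [covLaplace, neg_neg] at h
    change ((n : ℝ) + 1) • a (n + 1) z x + (radialOp hB x (α (n + 1))).1 z = _
    rw [hrad]
    refine h.trans ?_
    simp only [AddSubmonoidClass.coe_finsetSum, Finset.sum_apply]
    rfl
  have h := (evalAt_third_coefficient hB x hs).trans (contracted_words_eq hB x h0)
  have e0 : evalAt x (α 0) = 1 := ha.diag_zero x
  have e3 : evalAt x (α 3) = a 3 x x := rfl
  have eF : ∀ μ ν, evalAt x (curv hB μ ν) = fieldStrength B μ ν x := fun _ _ => rfl
  have eD : ∀ μ f, evalAt x (adjOp hB μ f) = adjDeriv B μ f.1 x := fun _ _ => rfl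
  simp only [map_add, map_mul, e0, e3, eF, eD, mul_one, ← mul_assoc] at h
  exact h

end HeatKernel

end

theorem mainTheorem7 {𝕜 : Type*} [RCLike 𝕜] (d N : ℕ)
    (B : Fin d → EuclideanSpace ℝ (Fin d) → Matrix (Fin N) (Fin N) 𝕜)
    (hB : ∀ μ, ContDiff ℝ ∞ (B μ)) :
    HeatKernel.IsClassicalSolution B (HeatKernel.seeleyDeWitt B) ∧
    ∀ a : ℕ → EuclideanSpace ℝ (Fin d) → EuclideanSpace ℝ (Fin d) → Matrix (Fin N) (Fin N) 𝕜,
      HeatKernel.IsClassicalSolution B a →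
      ∀ x : EuclideanSpace ℝ (Fin d),
        a 3 x x =
          (1 / 45 : ℝ) • ∑ μ, ∑ τ, ∑ ν,
              HeatKernel.adjDeriv B μ (HeatKernel.fieldStrength B τ ν) x *
                HeatKernel.adjDeriv B μ (HeatKernel.fieldStrength B τ ν) x
          + (1 / 180 : ℝ) • ∑ μ, ∑ τ, ∑ ν,
              HeatKernel.adjDeriv B μ (HeatKernel.fieldStrength B μ ν) x *
                HeatKernel.adjDeriv B τ (HeatKernel.fieldStrength B τ ν) x
          + (1 / 60 : ℝ) • ∑ μ, ∑ τ, ∑ ν,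
              (HeatKernel.fieldStrength B τ ν x *
                  HeatKernel.adjDeriv B μ
                    (HeatKernel.adjDeriv B μ (HeatKernel.fieldStrength B τ ν)) x
                + HeatKernel.adjDeriv B μ
                    (HeatKernel.adjDeriv B μ (HeatKernel.fieldStrength B τ ν)) x *
                  HeatKernel.fieldStrength B τ ν x)
          - (1 / 30 : ℝ) • ∑ μ, ∑ τ, ∑ ν,
              HeatKernel.fieldStrength B τ μ x * HeatKernel.fieldStrength B μ ν x *
                HeatKernel.fieldStrength B ν τ x := by
  have : CompleteSpace (Matrix (Fin N) (Fin N) 𝕜) := FiniteDimensional.complete ℝ _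
  exact ⟨HeatKernel.isClassicalSolution_seeleyDeWitt hB,
    fun a ha x => HeatKernel.thirdCoefficient_diagonal hB ha x⟩
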